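/- Let $n\in\mathbb N$ and $r>0$, let $C=\{x\in\mathbb R^n:|x|<r\}$ be the ball of radius $r$ and $V_C$ its volume. For $f:\mathbb R^n\to\mathbb C$ let $$f_C(x)=\frac1{V_C}\int_C f(x-x')\,dx'$$ be its post-average over $C$, and write $F(\omega)=(2\pi)^{-n/2}\int_{\mathbb R^n}e^{-i x\cdot\omega}f(x)\,dx$ for the Fourier transform of $f$ and $F_C$ for that of $f_C$. Let $J_\nu$ be the Bessel function of the first kind of order $\nu$, and set $$m(\omega)=\frac1{V_C}\int_C e^{-i x'\cdot\omega}\,dx'.$$ (1) The Fourier transform $H_r$ of the indicator function of $C$ satisfies, for all $\omega\ne0$, $$H_r(\omega)=|\omega|^{-\frac{n-2}2}\int_0^r J_{\frac{n-2}2}(|\omega|\rho)\,\rho^{\frac n2}\,d\rho=\Big(\frac r{|\omega|}\Big)^{\frac n2}J_{\frac n2}(r|\omega|).$$ (2) For all $\omega\neq 0$, $$m(\omega)=(2\pi)^{\frac n2}\,\frac{\Gamma(\frac n2+1)}{\pi^{n/2}}\,\frac{J_{n/2}(r|\omega|)}{(r|\omega|)^{n/2}},$$ and $m(0)=1$. The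 function $m$ is smooth, and it and all its derivatives have at most polynomial growth. (3) If $f$ is integrable, then $f_C$ is integrable, $F_C(\omega)=F(\omega)\,m(\omega)$ for every $\omega\in\mathbb R^n$, and hence for every $\omega\ne0$ $$F_C(\omega)=F(\omega)\,(2\pi)^{\frac n2}\,\frac{\Gamma(\frac n2+1)}{\pi^{n/2}}\,\frac{J_{n/2}(r|\omega|)}{(r|\omega|)^{n/2}}.$$ (4) If $(1+|x|)^{-k}f(x)$ is integrable for some $k\in\mathbb N$ (for example, if $f$ is continuous and piecewise linear), then $f_C$ has the same property (possibly with another $k$), and $F_C=m\,F$ as tempered distributions, that is, $\int f_C\,\widehat\varphi=\int f\,\widehat{m\varphi}$ for every Schwartz function $\varphi$, where $\widehat{\ }$ is the Fourier transform above. -/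

import Mathlib

open MeasureTheory Complex
open scoped Nat SchwartzMap

/-- The Bessel function of the first kind of real order `ν`, for arguments `x > 0`, by its power
series. (`Real.Gamma` is `0` at its poles, so the corresponding terms vanish, as they should.) -/
noncomputable def besselJ (ν x : ℝ) : ℝ :=
  ∑' m : ℕ, (-1) ^ m / ((m ! : ℝ) * Real.Gamma (m + ν + 1)) * (x / 2) ^ (2 * (m : ℝ) + ν)

/-- The Fourier transform in the unitary angular-frequency convention:
`F(ω) = (2π)^(-n/2) ∫ e^(-i x·ω) f(x) dx`. -/
noncomputable def unitaryFourier {n : ℕ} (f : EuclideanSpace ℝ (Fin n) → ℂ)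
    (ω : EuclideanSpace ℝ (Fin n)) : ℂ :=
  (((2 * Real.pi) ^ (-((n : ℝ) / 2)) : ℝ) : ℂ) *
    ∫ x, cexp (-(I * ((inner ℝ x ω : ℝ) : ℂ))) * f x

/-- Post-averaging of `f` over the neighbourhood `C` of the origin. -/
noncomputable def postAverage {n : ℕ} (C : Set (EuclideanSpace ℝ (Fin n)))
    (f : EuclideanSpace ℝ (Fin n) → ℂ) (x : EuclideanSpace ℝ (Fin n)) : ℂ :=
  (1 / ((volume.real C : ℝ) : ℂ)) * ∫ x' in C, f (x - x')

/-- `(1 / V_C) ∫_{x' ∈ C} e^(-i x'·ω) dx'`. -/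
noncomputable def averagingMultiplier {n : ℕ} (C : Set (EuclideanSpace ℝ (Fin n)))
    (ω : EuclideanSpace ℝ (Fin n)) : ℂ :=
  (1 / ((volume.real C : ℝ) : ℂ)) * ∫ x' in C, cexp (-(I * ((inner ℝ x' ω : ℝ) : ℂ)))

/-- `f` becomes integrable after division by some power of `1 + |x|`. Every measurable function of
at most polynomial growth, and every function in some `L^p`, has this property. -/
def IsTemperedFunction {n : ℕ} (f : EuclideanSpace ℝ (Fin n) → ℂ) : Prop :=
  ∃ k : ℕ, Integrable (fun x => f x / (((1 + ‖x‖) ^ k : ℝ) : ℂ))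

/-- The value `⟨F, ψ⟩ = ∫ f(x) ψ̂(x) dx` on a test function `ψ` of the Fourier transform `F` of `f`
in the sense of tempered distributions. -/
noncomputable def distribFourier {n : ℕ} (f ψ : EuclideanSpace ℝ (Fin n) → ℂ) : ℂ :=
  ∫ x, f x * unitaryFourier ψ x

/-!
The Fourier integral of a ball is computed from its moments. Expanding the exponential reduces
`∫_{|x| < r} exp (-i x·ω) dx` to the moments `∫_{|x| < r} (x·ω)^k dx`, of which the odd ones vanish
by symmetry. For the even ones, the Gaussian integral `∫ (x·u)^(2m) exp (-|x|²) dx` with `|u| = 1`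
is evaluated in two ways: in an orthonormal basis containing `u` it is a product of one-dimensional
integrals, with value `Γ(m + 1/2) π^((n-1)/2)`
(`integral_inner_pow_mul_exp_neg_norm_sq`); writing `exp (-|x|²)` as the integral of `2t exp (-t²)`
over `t > |x|`, it is the moment of the unit ball times `Γ(m + n/2 + 1)`
(`integral_mul_exp_neg_norm_sq_eq` and homogeneity). The resulting power series is that of
`J_{n/2}` (`setIntegral_ball_cexp_inner`). The integral formula with `J_{(n-2)/2}` then follows from
the recurrence `(x^ν J_ν)' = x^ν J_{ν-1}`, which is proved in integrated form by termwise
integration (`integral_besselJ_sub_one_mul_rpow`).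

The statements on averages rest on one application of Fubini's theorem,
`∫ f_C(x) h(x) dx = ∫ f(y) (1/V_C) ∫_C h(y + x') dx' dy` (`integral_postAverage_mul`), valid as soon
as `f / (1 + |x|)^k` is integrable and `h` is continuous and `O((1 + |x|)^(-k))`. With
`h = exp (-i x·ω)` and `k = 0` it gives `F_C = F m`. With `h` the Fourier transform of a Schwartz
function `ψ` it gives the identity of tempered distributions, because the average of this `h` is
the Fourier transform of `m ψ` (`unitaryFourier_averagingMultiplier_mul`). The multiplier is
smooth with bounded derivatives, being the Fourier transform of a function of bounded support.
-/

/-! ### Averaging against a test function -/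

/-- If `f` is integrable after division by `(1 + |x|) ^ k` and `h` decays like `(1 + |x|) ^ (-k)`,
then the double integral to which Fubini's theorem is applied converges absolutely, because
`1 + |x|` and `1 + |x - x'|` are comparable for `x'` in a ball. -/
lemma integrable_prod_sub_mul {n : ℕ} {r : ℝ} {f h : EuclideanSpace ℝ (Fin n) → ℂ} {k : ℕ} {A : ℝ}
    (hf : Integrable (fun x => f x / (((1 + ‖x‖) ^ k : ℝ) : ℂ))) (hh : Continuous h)
    (hA : ∀ x, (1 + ‖x‖) ^ k * ‖h x‖ ≤ A) :
    Integrable (fun p : EuclideanSpace ℝ (Fin n) × EuclideanSpace ℝ (Fin n) =>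
      f (p.1 - p.2) * h p.1) (volume.prod (volume.restrict (Metric.ball 0 r))) := by
  have : IsFiniteMeasure
      ((volume : Measure (EuclideanSpace ℝ (Fin n))).restrict (Metric.ball 0 r)) :=
    isFiniteMeasure_restrict.2 measure_ball_lt_top.ne
  -- The shear `(x, x') ↦ (x - x', x')` preserves the product measure.
  have hshear := measurePreserving_sub_prod (volume : Measure (EuclideanSpace ℝ (Fin n)))
    (volume.restrict (Metric.ball 0 r))
  have hg := hshear.integrable_comp_of_integrable
    (hf.comp_fst (volume.restrict (Metric.ball (0 : EuclideanSpace ℝ (Fin n)) r)))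
  have hmem : ∀ᵐ p ∂((volume : Measure (EuclideanSpace ℝ (Fin n))).prod
      (volume.restrict (Metric.ball 0 r))), p.2 ∈ Metric.ball (0 : EuclideanSpace ℝ (Fin n)) r :=
    Measure.quasiMeasurePreserving_snd.ae (ae_restrict_mem measurableSet_ball)
  have hw : Continuous (fun p : EuclideanSpace ℝ (Fin n) × EuclideanSpace ℝ (Fin n) =>
      (((1 + ‖p.1 - p.2‖) ^ k : ℝ) : ℂ) * h p.1) := by fun_prop
  refine (hg.mul_bdd (c := (1 + r) ^ k * A) hw.aestronglyMeasurable ?_).congr ?_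
  · filter_upwards [hmem] with p hp
    rw [mem_ball_zero_iff] at hp
    have hr : 0 < r := (norm_nonneg _).trans_lt hp
    have h1 : 1 + ‖p.1 - p.2‖ ≤ (1 + r) * (1 + ‖p.1‖) := by
      have := norm_sub_le p.1 p.2
      nlinarith [norm_nonneg p.1]
    have h2 : ‖(((1 + ‖p.1 - p.2‖) ^ k : ℝ) : ℂ)‖ = (1 + ‖p.1 - p.2‖) ^ k := by
      rw [Complex.norm_real, Real.norm_of_nonneg (by positivity)]
    rw [norm_mul, h2]
    calc (1 + ‖p.1 - p.2‖) ^ k * ‖h p.1‖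
        ≤ ((1 + r) * (1 + ‖p.1‖)) ^ k * ‖h p.1‖ := by gcongr
      _ = (1 + r) ^ k * ((1 + ‖p.1‖) ^ k * ‖h p.1‖) := by rw [mul_pow, mul_assoc]
      _ ≤ (1 + r) ^ k * A := by gcongr; exact hA _
  · refine Filter.Eventually.of_forall fun p => ?_
    have : (((1 + ‖p.1 - p.2‖) ^ k : ℝ) : ℂ) ≠ 0 := by
      rw [Complex.ofReal_ne_zero]; positivity
    simp only [Function.comp_apply]
    field_simp

lemma integrable_postAverage_mul {n : ℕ} {r : ℝ} {f h : EuclideanSpace ℝ (Fin n) → ℂ} {k : ℕ}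
    {A : ℝ} (hf : Integrable (fun x => f x / (((1 + ‖x‖) ^ k : ℝ) : ℂ))) (hh : Continuous h)
    (hA : ∀ x, (1 + ‖x‖) ^ k * ‖h x‖ ≤ A) :
    Integrable (fun x => postAverage (Metric.ball 0 r) f x * h x) := by
  refine (((integrable_prod_sub_mul (r := r) hf hh hA).integral_prod_left).const_mul
    (1 / ((volume.real (Metric.ball (0 : EuclideanSpace ℝ (Fin n)) r) : ℝ) : ℂ))).congr ?_
  refine Filter.Eventually.of_forall fun x => ?_
  simp only [postAverage, integral_mul_const, mul_assoc]

/-- Averaging is transposed to averaging over the reflected set: this is the only use of Fubini's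
theorem on the whole space. -/
lemma integral_postAverage_mul {n : ℕ} {r : ℝ} {f h : EuclideanSpace ℝ (Fin n) → ℂ} {k : ℕ}
    {A : ℝ} (hf : Integrable (fun x => f x / (((1 + ‖x‖) ^ k : ℝ) : ℂ))) (hh : Continuous h)
    (hA : ∀ x, (1 + ‖x‖) ^ k * ‖h x‖ ≤ A) :
    ∫ x, postAverage (Metric.ball 0 r) f x * h x =
      ∫ y, f y * (1 / ((volume.real (Metric.ball (0 : EuclideanSpace ℝ (Fin n)) r) : ℝ) : ℂ) *
        ∫ x' in Metric.ball 0 r, h (y + x')) := by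
  have : IsFiniteMeasure
      ((volume : Measure (EuclideanSpace ℝ (Fin n))).restrict (Metric.ball 0 r)) :=
    isFiniteMeasure_restrict.2 measure_ball_lt_top.ne
  have hint := integrable_prod_sub_mul (r := r) hf hh hA
  have hadd := measurePreserving_add_prod (volume : Measure (EuclideanSpace ℝ (Fin n)))
    (volume.restrict (Metric.ball 0 r))
  have hint' : Integrable (fun p : EuclideanSpace ℝ (Fin n) × EuclideanSpace ℝ (Fin n) =>
      f p.1 * h (p.1 + p.2)) (volume.prod (volume.restrict (Metric.ball 0 r))) := by
    refine (hadd.integrable_comp_of_integrable hint).congr ?_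
    exact Filter.Eventually.of_forall fun p => by simp
  simp only [postAverage, mul_assoc, ← integral_mul_const]
  rw [integral_const_mul, integral_integral_swap hint]
  have hshift : ∀ x' : EuclideanSpace ℝ (Fin n),
      ∫ x, f (x - x') * h x = ∫ y, f y * h (y + x') := fun x' => by
    rw [← integral_add_right_eq_self _ x']
    simp
  simp only [hshift]
  rw [← integral_integral_swap hint']
  simp only [integral_const_mul]
  rw [← integral_const_mul]
  congr 1 with y
  ring

/-- The case of the test function `exp (-i x·ω)`. -/
lemma unitaryFourier_postAverage {n : ℕ} {r : ℝ} {f : EuclideanSpace ℝ (Fin n) → ℂ}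
    (hf : Integrable f) (ω : EuclideanSpace ℝ (Fin n)) :
    unitaryFourier (postAverage (Metric.ball 0 r) f) ω =
      unitaryFourier f ω * averagingMultiplier (Metric.ball 0 r) ω := by
  have key := integral_postAverage_mul (r := r) (f := f) (k := 0) (A := 1)
    (h := fun x => cexp (-(I * ((inner ℝ x ω : ℝ) : ℂ)))) (by simpa using hf) (by fun_prop)
    (fun x => by simp [Complex.norm_exp])
  have hexp : ∀ y x' : EuclideanSpace ℝ (Fin n), cexp (-(I * ((inner ℝ (y + x') ω : ℝ) : ℂ))) =
      cexp (-(I * ((inner ℝ y ω : ℝ) : ℂ))) * cexp (-(I * ((inner ℝ x' ω : ℝ) : ℂ))) := by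
    intro y x'
    rw [← Complex.exp_add, inner_add_left]
    push_cast
    ring_nf
  simp only [hexp, integral_const_mul] at key
  simp only [unitaryFourier, averagingMultiplier]
  rw [mul_assoc, ← integral_mul_const]
  congr 1
  rw [← integral_congr_ae (Filter.Eventually.of_forall fun x => mul_comm _ _), key]
  congr 1 with y
  ring

lemma isTemperedFunction_postAverage {n : ℕ} {r : ℝ} {f : EuclideanSpace ℝ (Fin n) → ℂ}
    (hf : IsTemperedFunction f) : IsTemperedFunction (postAverage (Metric.ball 0 r) f) := by
  obtain ⟨k, hk⟩ := hf
  refine ⟨k, ?_⟩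
  have hpos : ∀ x : EuclideanSpace ℝ (Fin n), 0 < (1 + ‖x‖) ^ k := fun x => by positivity
  have := integrable_postAverage_mul (r := r) (A := 1) hk
    (h := fun x => ((((1 + ‖x‖) ^ k)⁻¹ : ℝ) : ℂ))
    (Complex.continuous_ofReal.comp ((by fun_prop : Continuous fun x : EuclideanSpace ℝ (Fin n) =>
      (1 + ‖x‖) ^ k).inv₀ fun x => (hpos x).ne'))
    (fun x => by
      rw [Complex.norm_real, Real.norm_of_nonneg (inv_nonneg.2 (hpos x).le),
        mul_inv_cancel₀ (hpos x).ne'])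
  refine this.congr (Filter.Eventually.of_forall fun x => ?_)
  simp only [Complex.ofReal_inv, div_eq_mul_inv]

/-! ### Comparison with the Fourier transform of Mathlib -/

open scoped FourierTransform

lemma integral_cexp_inner_mul_eq_fourier {n : ℕ} (f : EuclideanSpace ℝ (Fin n) → ℂ)
    (ω : EuclideanSpace ℝ (Fin n)) :
    ∫ x, cexp (-(I * ((inner ℝ x ω : ℝ) : ℂ))) * f x = 𝓕 f ((2 * Real.pi)⁻¹ • ω) := by
  rw [Real.fourier_eq']
  congr 1 with x
  rw [inner_smul_right, smul_eq_mul]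
  congr 2
  have : (Real.pi : ℂ) ≠ 0 := by simp [Real.pi_ne_zero]
  push_cast
  field_simp

lemma unitaryFourier_eq_fourier {n : ℕ} (f : EuclideanSpace ℝ (Fin n) → ℂ)
    (ω : EuclideanSpace ℝ (Fin n)) :
    unitaryFourier f ω = (((2 * Real.pi) ^ (-((n : ℝ) / 2)) : ℝ) : ℂ) *
      𝓕 f ((2 * Real.pi)⁻¹ • ω) := by
  rw [unitaryFourier, integral_cexp_inner_mul_eq_fourier]

lemma setIntegral_cexp_inner {n : ℕ} {C : Set (EuclideanSpace ℝ (Fin n))} (hC : MeasurableSet C)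
    (ω : EuclideanSpace ℝ (Fin n)) :
    ∫ x in C, cexp (-(I * ((inner ℝ x ω : ℝ) : ℂ))) =
      ∫ x, cexp (-(I * ((inner ℝ x ω : ℝ) : ℂ))) * C.indicator (fun _ => (1 : ℂ)) x := by
  rw [← integral_indicator hC]
  congr 1 with x
  by_cases hx : x ∈ C <;> simp [hx]

lemma continuous_unitaryFourier_schwartz {n : ℕ} (ψ : 𝓢(EuclideanSpace ℝ (Fin n), ℂ)) :
    Continuous (unitaryFourier ψ) := by
  have h : unitaryFourier ψ = fun ω => (((2 * Real.pi) ^ (-((n : ℝ) / 2)) : ℝ) : ℂ) *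
      (𝓕 ψ) ((2 * Real.pi)⁻¹ • ω) := funext fun ω => by
    rw [unitaryFourier_eq_fourier, SchwartzMap.fourier_coe]
  rw [h]
  exact continuous_const.mul ((𝓕 ψ).continuous.comp (continuous_const_smul _))

lemma exists_decay_unitaryFourier_schwartz {n : ℕ} (ψ : 𝓢(EuclideanSpace ℝ (Fin n), ℂ)) (k : ℕ) :
    ∃ A, ∀ x, (1 + ‖x‖) ^ k * ‖unitaryFourier ψ x‖ ≤ A := by
  have hpi : 1 ≤ 2 * Real.pi := by linarith [Real.pi_gt_three]
  set c : ℂ := (((2 * Real.pi) ^ (-((n : ℝ) / 2)) : ℝ) : ℂ)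
  set B := 2 ^ k * (Finset.Iic (k, 0)).sup
    (fun m => SchwartzMap.seminorm ℝ (E := EuclideanSpace ℝ (Fin n)) (F := ℂ) m.1 m.2) (𝓕 ψ)
  refine ⟨(2 * Real.pi) ^ k * (‖c‖ * B), fun x => ?_⟩
  have h := SchwartzMap.one_add_le_sup_seminorm_apply (𝕜 := ℝ) (m := (k, 0)) le_rfl le_rfl (𝓕 ψ)
    ((2 * Real.pi)⁻¹ • x)
  rw [norm_iteratedFDeriv_zero, norm_smul, Real.norm_of_nonneg (by positivity)] at h
  have h1 : 1 + ‖x‖ ≤ (2 * Real.pi) * (1 + (2 * Real.pi)⁻¹ * ‖x‖) := by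
    rw [mul_add, mul_inv_cancel_left₀ (by positivity)]
    linarith
  rw [unitaryFourier_eq_fourier, norm_mul, ← SchwartzMap.fourier_coe]
  calc (1 + ‖x‖) ^ k * (‖c‖ * ‖(𝓕 ψ) ((2 * Real.pi)⁻¹ • x)‖)
      ≤ ((2 * Real.pi) * (1 + (2 * Real.pi)⁻¹ * ‖x‖)) ^ k *
        (‖c‖ * ‖(𝓕 ψ) ((2 * Real.pi)⁻¹ • x)‖) := by gcongr
    _ = (2 * Real.pi) ^ k * (‖c‖ * ((1 + (2 * Real.pi)⁻¹ * ‖x‖) ^ k *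
        ‖(𝓕 ψ) ((2 * Real.pi)⁻¹ • x)‖)) := by rw [mul_pow]; ring
    _ ≤ (2 * Real.pi) ^ k * (‖c‖ * B) := by gcongr

/-! ### The multiplier -/

/-- The Fourier transform of a bounded measurable set is smooth with bounded derivatives, since
all moments of the set are finite. -/
lemma hasTemperateGrowth_fourier_indicator {n : ℕ} {C : Set (EuclideanSpace ℝ (Fin n))}
    (hC : MeasurableSet C) (hb : Bornology.IsBounded C) :
    (𝓕 (C.indicator (fun _ => (1 : ℂ)))).HasTemperateGrowth := by
  have hsm : AEStronglyMeasurable (C.indicator (fun _ => (1 : ℂ)))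
      (volume : Measure (EuclideanSpace ℝ (Fin n))) :=
    aestronglyMeasurable_const.indicator hC
  obtain ⟨R, hR⟩ := hb.exists_norm_le
  have hmom : ∀ k : ℕ, Integrable (fun v => ‖v‖ ^ k * ‖C.indicator (fun _ => (1 : ℂ)) v‖) := by
    intro k
    have h1 : IntegrableOn (fun _ : EuclideanSpace ℝ (Fin n) => R ^ k) C :=
      integrableOn_const hb.measure_lt_top.ne
    refine (h1.integrable_indicator hC).mono' (by fun_prop)
      (Filter.Eventually.of_forall fun v => ?_)
    by_cases hv : v ∈ C
    · simp only [hv, Set.indicator_of_mem, norm_one, mul_one, norm_pow, norm_norm]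
      exact pow_le_pow_left₀ (norm_nonneg _) (hR v hv) k
    · simp [hv]
  refine ⟨Real.contDiff_fourier (N := ⊤) fun k _ => hmom k, fun k => ⟨0,
    ∫ v, ‖VectorFourier.fourierPowSMulRight (innerSL ℝ) (C.indicator (fun _ => (1 : ℂ))) v k‖,
    fun x => ?_⟩⟩
  rw [Real.iteratedFDeriv_fourier (N := ⊤) (fun k _ => hmom k) hsm le_top, pow_zero, mul_one]
  exact VectorFourier.norm_fourierIntegral_le_integral_norm _ _ _ _ _

lemma hasTemperateGrowth_averagingMultiplier {n : ℕ} {C : Set (EuclideanSpace ℝ (Fin n))}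
    (hC : MeasurableSet C) (hb : Bornology.IsBounded C) :
    (averagingMultiplier C).HasTemperateGrowth := by
  have h : averagingMultiplier C = fun ω => (1 / ((volume.real C : ℝ) : ℂ)) *
      𝓕 (C.indicator (fun _ => (1 : ℂ))) ((2 * Real.pi)⁻¹ • ω) := funext fun ω => by
    rw [averagingMultiplier, setIntegral_cexp_inner hC, integral_cexp_inner_mul_eq_fourier]
  rw [h]
  refine (Function.HasTemperateGrowth.const _).mul ?_
  exact (hasTemperateGrowth_fourier_indicator hC hb).comp
    (f := fun ω => (2 * Real.pi)⁻¹ • ω)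
    ((2 * Real.pi)⁻¹ • ContinuousLinearMap.id ℝ (EuclideanSpace ℝ (Fin n))).hasTemperateGrowth

lemma averagingMultiplier_ball_zero {n : ℕ} {r : ℝ} (hr : 0 < r) :
    averagingMultiplier (Metric.ball (0 : EuclideanSpace ℝ (Fin n)) r) 0 = 1 := by
  have : (volume.real (Metric.ball (0 : EuclideanSpace ℝ (Fin n)) r) : ℂ) ≠ 0 :=
    Complex.ofReal_ne_zero.2
      (ENNReal.toReal_pos (Metric.measure_ball_pos _ _ hr).ne' measure_ball_lt_top.ne).ne'
  simp [averagingMultiplier, this]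

/-- Multiplication by the multiplier becomes, after Fourier transformation, averaging over the
reflected set. -/
lemma unitaryFourier_averagingMultiplier_mul {n : ℕ} {r : ℝ}
    {ψ : EuclideanSpace ℝ (Fin n) → ℂ} (hψ : Integrable ψ) (y : EuclideanSpace ℝ (Fin n)) :
    unitaryFourier (fun ω => averagingMultiplier (Metric.ball 0 r) ω * ψ ω) y =
      1 / ((volume.real (Metric.ball (0 : EuclideanSpace ℝ (Fin n)) r) : ℝ) : ℂ) *
        ∫ x' in Metric.ball 0 r, unitaryFourier ψ (y + x') := by
  have : IsFiniteMeasure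
      ((volume : Measure (EuclideanSpace ℝ (Fin n))).restrict (Metric.ball 0 r)) :=
    isFiniteMeasure_restrict.2 measure_ball_lt_top.ne
  have hint : Integrable (fun p : EuclideanSpace ℝ (Fin n) × EuclideanSpace ℝ (Fin n) =>
      cexp (-(I * ((inner ℝ p.1 (y + p.2) : ℝ) : ℂ))) * ψ p.1)
      (volume.prod (volume.restrict (Metric.ball 0 r))) := by
    refine (hψ.comp_fst _).bdd_mul (c := 1) (Continuous.aestronglyMeasurable (by fun_prop))
      (Filter.Eventually.of_forall fun p => ?_)
    simp [Complex.norm_exp]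
  simp only [unitaryFourier, averagingMultiplier]
  rw [integral_const_mul, ← integral_integral_swap hint, mul_left_comm (1 / _)]
  congr 1
  rw [← integral_const_mul]
  congr 1 with ω
  rw [integral_mul_const]
  have hexp : ∀ x' : EuclideanSpace ℝ (Fin n), cexp (-(I * ((inner ℝ ω (y + x') : ℝ) : ℂ))) =
      cexp (-(I * ((inner ℝ ω y : ℝ) : ℂ))) * cexp (-(I * ((inner ℝ x' ω : ℝ) : ℂ))) := by
    intro x'
    rw [← Complex.exp_add, inner_add_right, real_inner_comm x' ω]
    push_cast
    ring_nf
  simp only [hexp, integral_const_mul]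
  ring

lemma distribFourier_postAverage {n : ℕ} {r : ℝ} {f : EuclideanSpace ℝ (Fin n) → ℂ}
    (hf : IsTemperedFunction f) (ψ : 𝓢(EuclideanSpace ℝ (Fin n), ℂ)) :
    distribFourier (postAverage (Metric.ball 0 r) f) ψ =
      distribFourier f (fun ω => averagingMultiplier (Metric.ball 0 r) ω * ψ ω) := by
  obtain ⟨k, hk⟩ := hf
  obtain ⟨A, hA⟩ := exists_decay_unitaryFourier_schwartz ψ k
  simp only [distribFourier, unitaryFourier_averagingMultiplier_mul ψ.integrable]
  exact integral_postAverage_mul hk (continuous_unitaryFourier_schwartz ψ) hA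

/-! ### Moments of balls -/

lemma integral_pow_mul_exp_neg_sq (m : ℕ) :
    ∫ x : ℝ, x ^ (2 * m) * Real.exp (-x ^ 2) = Real.Gamma (m + 1 / 2) := by
  have h1 := integral_comp_abs (f := fun x : ℝ => x ^ (2 * m) * Real.exp (-x ^ 2))
  simp only [sq_abs, (even_two_mul m).pow_abs] at h1
  have h2 := _root_.integral_rpow_mul_exp_neg_rpow (p := 2) (q := ((2 * m : ℕ) : ℝ)) (by norm_num)
    (by linarith [(Nat.cast_nonneg (2 * m) : (0 : ℝ) ≤ _)])
  have h3 : ∫ x in Set.Ioi (0 : ℝ), x ^ (2 * m) * Real.exp (-x ^ 2) =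
      1 / 2 * Real.Gamma (m + 1 / 2) := by
    rw [show (m : ℝ) + 1 / 2 = (((2 * m : ℕ) : ℝ) + 1) / 2 by push_cast; ring, ← h2]
    simp only [Real.rpow_natCast, Real.rpow_two]
  rw [h1, h3]
  ring

/-- Gaussian moments along a unit vector, computed in an orthonormal basis containing it. -/
lemma integral_inner_pow_mul_exp_neg_norm_sq {n : ℕ} (m : ℕ) {u : EuclideanSpace ℝ (Fin n)}
    (hu : ‖u‖ = 1) :
    ∫ x, inner ℝ x u ^ (2 * m) * Real.exp (-‖x‖ ^ 2) =
      Real.Gamma (m + 1 / 2) * √Real.pi ^ (n - 1) := by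
  have hn : 0 < n := by
    rcases Nat.eq_zero_or_pos n with rfl | h
    · simp [Subsingleton.elim u 0] at hu
    · exact h
  let i₀ : Fin n := ⟨0, hn⟩
  obtain ⟨b, hb⟩ := Orthonormal.exists_orthonormalBasis_extension_of_card_eq (𝕜 := ℝ)
    (E := EuclideanSpace ℝ (Fin n)) (ι := Fin n) (by simp) (v := fun _ => u) (s := {i₀})
    (by
      rw [orthonormal_iff_ite]
      rintro ⟨i, rfl⟩ ⟨j, rfl⟩
      simp [hu])
  have hb0 : b i₀ = u := hb i₀ rfl
  rw [← b.measurePreserving_repr_symm.integral_comp' (f := b.repr.symm.toMeasurableEquiv),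
    ← (PiLp.volume_preserving_toLp (Fin n)).integral_comp
      (MeasurableEquiv.toLp 2 (Fin n → ℝ)).measurableEmbedding]
  have hint : ∀ y : Fin n → ℝ,
      inner ℝ (b.repr.symm.toMeasurableEquiv (WithLp.toLp 2 y)) u ^ (2 * m) *
        Real.exp (-‖b.repr.symm.toMeasurableEquiv (WithLp.toLp 2 y)‖ ^ 2) =
      ∏ i, (if i = i₀ then y i ^ (2 * m) else 1) * Real.exp (-y i ^ 2) := by
    intro y
    have h1 : inner ℝ (b.repr.symm (WithLp.toLp 2 y)) u = y i₀ := by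
      rw [← hb0, real_inner_comm, ← b.repr_apply_apply, LinearIsometryEquiv.apply_symm_apply]
    have h2 : ‖b.repr.symm (WithLp.toLp 2 y)‖ ^ 2 = ∑ i, y i ^ 2 := by
      rw [LinearIsometryEquiv.norm_map, EuclideanSpace.real_norm_sq_eq]
    simp only [LinearIsometryEquiv.coe_toMeasurableEquiv]
    rw [h1, h2, Finset.prod_mul_distrib, ← Finset.sum_neg_distrib, Real.exp_sum]
    simp
  simp only [hint]
  rw [integral_fintype_prod_volume_eq_prod
    (fun i (t : ℝ) => (if i = i₀ then t ^ (2 * m) else 1) * Real.exp (-t ^ 2)),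
    ← Finset.mul_prod_erase _ _ (Finset.mem_univ i₀)]
  have h0 : ∫ t : ℝ, Real.exp (-t ^ 2) = √Real.pi := by simpa using integral_gaussian 1
  congr 1
  · simpa using integral_pow_mul_exp_neg_sq m
  · rw [Finset.prod_congr rfl (g := fun _ => √Real.pi)]
    · simp
    · intro i hi
      simp [Finset.ne_of_mem_erase hi, h0]

lemma integrableOn_and_integral_Ioi_two_mul_exp_neg_sq {a : ℝ} (ha : 0 ≤ a) :
    IntegrableOn (fun t : ℝ => 2 * t * Real.exp (-t ^ 2)) (Set.Ioi a) ∧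
      ∫ t in Set.Ioi a, 2 * t * Real.exp (-t ^ 2) = Real.exp (-a ^ 2) := by
  have hderiv : ∀ t ∈ Set.Ici a,
      HasDerivAt (fun t : ℝ => -Real.exp (-t ^ 2)) (2 * t * Real.exp (-t ^ 2)) t := fun t _ => by
    convert! ((hasDerivAt_pow 2 t).fun_neg.exp).fun_neg using 1
    simp
    ring
  have hpos : ∀ t ∈ Set.Ioi a, 0 ≤ 2 * t * Real.exp (-t ^ 2) := fun t ht => by
    have : 0 < t := ha.trans_lt ht
    positivity
  have hlim : Filter.Tendsto (fun t : ℝ => -Real.exp (-t ^ 2)) Filter.atTop (nhds 0) := by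
    rw [← neg_zero]
    exact (Real.tendsto_exp_atBot.comp
      (Filter.tendsto_neg_atTop_atBot.comp (Filter.tendsto_pow_atTop two_ne_zero))).neg
  refine ⟨integrableOn_Ioi_deriv_of_nonneg' hderiv hpos hlim, ?_⟩
  rw [integral_Ioi_of_hasDerivAt_of_nonneg' hderiv hpos hlim]
  simp

/-- Layer-cake decomposition of a Gaussian integral into integrals over balls. -/
lemma integral_mul_exp_neg_norm_sq_eq {n : ℕ} {g : EuclideanSpace ℝ (Fin n) → ℝ}
    (hg : Continuous g) (hint : Integrable (fun x => g x * Real.exp (-‖x‖ ^ 2))) :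
    ∫ x, g x * Real.exp (-‖x‖ ^ 2) =
      ∫ t in Set.Ioi (0 : ℝ), 2 * t * Real.exp (-t ^ 2) * ∫ x in Metric.ball 0 t, g x := by
  let w : ℝ → ℝ := fun t => 2 * t * Real.exp (-t ^ 2)
  let S : Set (EuclideanSpace ℝ (Fin n) × ℝ) := {p | ‖p.1‖ < p.2}
  have hS : MeasurableSet S :=
    (isOpen_lt (continuous_fst.norm) continuous_snd).measurableSet
  let G : EuclideanSpace ℝ (Fin n) × ℝ → ℝ := S.indicator fun p => g p.1 * w p.2
  have hsec : ∀ (c : ℝ) (x : EuclideanSpace ℝ (Fin n)),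
      (fun t => S.indicator (fun p => c * w p.2) (x, t)) =
        (Set.Ioi ‖x‖).indicator fun t => c * w t := fun c x => by
    ext t
    simp only [S, Set.indicator, Set.mem_ofPred_eq, Set.mem_Ioi]
  have hsub : ∀ x : EuclideanSpace ℝ (Fin n), Set.Ioi ‖x‖ ∩ Set.Ioi 0 = Set.Ioi ‖x‖ := fun x =>
    Set.inter_eq_left.2 (Set.Ioi_subset_Ioi (norm_nonneg x))
  have hsecint : ∀ (c : ℝ) (x : EuclideanSpace ℝ (Fin n)),
      Integrable ((Set.Ioi ‖x‖).indicator fun t => c * w t) (volume.restrict (Set.Ioi 0)) :=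
    fun c x => by
      rw [integrable_indicator_iff measurableSet_Ioi, IntegrableOn,
        Measure.restrict_restrict measurableSet_Ioi, hsub]
      exact (integrableOn_and_integral_Ioi_two_mul_exp_neg_sq (norm_nonneg x)).1.const_mul c
  have hsecval : ∀ (c : ℝ) (x : EuclideanSpace ℝ (Fin n)),
      ∫ t in Set.Ioi (0 : ℝ), (Set.Ioi ‖x‖).indicator (fun t => c * w t) t =
        c * Real.exp (-‖x‖ ^ 2) := fun c x => by
    rw [integral_indicator measurableSet_Ioi, Measure.restrict_restrict measurableSet_Ioi, hsub,
      integral_const_mul, (integrableOn_and_integral_Ioi_two_mul_exp_neg_sq (norm_nonneg x)).2]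
  have hGsec : ∀ x, (fun t => G (x, t)) = (Set.Ioi ‖x‖).indicator fun t => g x * w t :=
    fun x => by rw [← hsec]; rfl
  have hGm : AEStronglyMeasurable G (volume.prod (volume.restrict (Set.Ioi 0))) :=
    (Continuous.aestronglyMeasurable (by fun_prop)).indicator hS
  have hG : Integrable G (volume.prod (volume.restrict (Set.Ioi 0))) := by
    rw [integrable_prod_iff hGm]
    refine ⟨Filter.Eventually.of_forall fun x => by rw [hGsec]; exact hsecint _ _, ?_⟩
    refine hint.norm.congr (Filter.Eventually.of_forall fun x => ?_)
    have habs : ∀ t, ‖G (x, t)‖ = (Set.Ioi ‖x‖).indicator (fun t => |g x| * w t) t := fun t => by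
      rw [show G (x, t) = (Set.Ioi ‖x‖).indicator (fun t => g x * w t) t from
        congrFun (hGsec x) t, norm_indicator_eq_indicator_norm]
      refine congrFun (Set.indicator_congr fun s hs => ?_) t
      have : 0 < s := (norm_nonneg x).trans_lt hs
      have hw : 0 ≤ w s := by positivity
      rw [norm_mul, Real.norm_eq_abs, Real.norm_of_nonneg hw]
    simp only [habs]
    rw [hsecval, norm_mul, Real.norm_eq_abs, Real.norm_of_nonneg (Real.exp_pos _).le]
  calc ∫ x, g x * Real.exp (-‖x‖ ^ 2) = ∫ x, ∫ t in Set.Ioi (0 : ℝ), G (x, t) := by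
        congr 1 with x
        rw [hGsec, hsecval]
    _ = ∫ t in Set.Ioi (0 : ℝ), ∫ x, G (x, t) := integral_integral_swap hG
    _ = _ := by
        congr 1 with t
        rw [← integral_const_mul, ← integral_indicator measurableSet_ball]
        congr 1 with x
        simp only [G, S, w, Set.indicator, Set.mem_ofPred_eq, mem_ball_zero_iff]
        split_ifs <;> ring

lemma setIntegral_ball_inner_pow_eq_mul {n : ℕ} (k : ℕ) (u : EuclideanSpace ℝ (Fin n)) {t : ℝ}
    (ht : 0 < t) :
    ∫ x in Metric.ball 0 t, inner ℝ x u ^ k =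
      t ^ (n + k) * ∫ x in Metric.ball 0 1, inner ℝ x u ^ k := by
  have h := Measure.setIntegral_comp_smul_of_pos volume
    (fun x : EuclideanSpace ℝ (Fin n) => inner ℝ x u ^ k) (Metric.ball 0 1) ht
  rw [smul_unitBall_of_pos ht, finrank_euclideanSpace_fin] at h
  simp only [inner_smul_left, mul_pow, integral_const_mul, smul_eq_mul,
    conj_trivial] at h
  rw [pow_add, mul_assoc, h, mul_inv_cancel_left₀ (by positivity)]

/-- Even moments of a ball along a unit vector: the Gaussian moment is, by the layer-cake
decomposition and homogeneity, the moment of the unit ball times a value of the Gamma function. -/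
lemma setIntegral_ball_inner_pow_of_norm_eq_one {n : ℕ} (m : ℕ) {u : EuclideanSpace ℝ (Fin n)}
    (hu : ‖u‖ = 1) {r : ℝ} (hr : 0 < r) :
    ∫ x in Metric.ball 0 r, inner ℝ x u ^ (2 * m) =
      r ^ (n + 2 * m) * (Real.Gamma (m + 1 / 2) * √Real.pi ^ (n - 1) /
        Real.Gamma (m + (n : ℝ) / 2 + 1)) := by
  rw [setIntegral_ball_inner_pow_eq_mul _ _ hr]
  congr 1
  have hΓ : 0 < Real.Gamma (m + (n : ℝ) / 2 + 1) := Real.Gamma_pos_of_pos (by positivity)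
  have hval := integral_inner_pow_mul_exp_neg_norm_sq m hu
  -- The Bochner integral of a non-integrable function is `0`, while this one is positive.
  have hint : Integrable fun x => inner ℝ x u ^ (2 * m) * Real.exp (-‖x‖ ^ 2) := by
    refine Integrable.of_integral_ne_zero ?_
    rw [hval]
    have : 0 < Real.Gamma (m + 1 / 2) := Real.Gamma_pos_of_pos (by positivity)
    have := Real.pi_pos
    positivity
  have hlayer := integral_mul_exp_neg_norm_sq_eq
    (g := fun x : EuclideanSpace ℝ (Fin n) => inner ℝ x u ^ (2 * m)) (by fun_prop) hint
  rw [eq_div_iff hΓ.ne', ← hval, hlayer]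
  have hrad := _root_.integral_rpow_mul_exp_neg_rpow (p := 2) (q := ((n + 2 * m + 1 : ℕ) : ℝ))
    (by norm_num) (by linarith [(Nat.cast_nonneg (n + 2 * m + 1) : (0 : ℝ) ≤ _)])
  have harg : (((n + 2 * m + 1 : ℕ) : ℝ) + 1) / 2 = m + (n : ℝ) / 2 + 1 := by push_cast; ring
  rw [harg] at hrad
  simp only [Real.rpow_natCast, Real.rpow_two] at hrad
  rw [setIntegral_congr_fun measurableSet_Ioi
    (g := fun t : ℝ => (2 * ∫ x in Metric.ball 0 1, inner ℝ x u ^ (2 * m)) *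
      (t ^ (n + 2 * m + 1) * Real.exp (-t ^ 2))), integral_const_mul, hrad]
  · ring
  · intro t ht
    simp only
    rw [setIntegral_ball_inner_pow_eq_mul _ _ ht]
    ring

lemma setIntegral_ball_inner_pow {n : ℕ} (m : ℕ) {ω : EuclideanSpace ℝ (Fin n)}
    (hω : ω ≠ 0) {r : ℝ} (hr : 0 < r) :
    ∫ x in Metric.ball 0 r, inner ℝ x ω ^ (2 * m) =
      ‖ω‖ ^ (2 * m) * (r ^ (n + 2 * m) * (Real.Gamma (m + 1 / 2) * √Real.pi ^ (n - 1) /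
        Real.Gamma (m + (n : ℝ) / 2 + 1))) := by
  have hu : ‖‖ω‖⁻¹ • ω‖ = 1 := norm_smul_inv_norm (𝕜 := ℝ) hω
  rw [← setIntegral_ball_inner_pow_of_norm_eq_one m hu hr, ← integral_const_mul]
  congr 1 with x
  rw [inner_smul_right, ← mul_pow, mul_inv_cancel_left₀ (norm_ne_zero_iff.2 hω)]

/-! ### The Fourier transform of a ball as a power series -/

lemma Real.Gamma_nat_add_half_eq_factorial (m : ℕ) :
    Real.Gamma (m + 1 / 2) = (2 * m)! * √Real.pi / (4 ^ m * m !) := by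
  induction m with
  | zero => simp [← Real.Gamma_one_half_eq]
  | succ m ih =>
    rw [show ((m + 1 : ℕ) : ℝ) + 1 / 2 = (m + 1 / 2) + 1 by push_cast; ring,
      Real.Gamma_add_one (by positivity), ih, show 2 * (m + 1) = 2 * m + 1 + 1 by ring,
      Nat.factorial_succ (2 * m + 1), Nat.factorial_succ (2 * m), Nat.factorial_succ m]
    push_cast
    field_simp
    ring

/-- The Fourier integral of a ball is real, because the ball is symmetric. -/
lemma setIntegral_ball_cexp_inner_eq_cos {n : ℕ} (r : ℝ) (ω : EuclideanSpace ℝ (Fin n)) :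
    ∫ x in Metric.ball 0 r, cexp (-(I * ((inner ℝ x ω : ℝ) : ℂ))) =
      ((∫ x in Metric.ball 0 r, Real.cos (inner ℝ x ω) : ℝ) : ℂ) := by
  have hint : IntegrableOn (fun x => cexp (-(I * ((inner ℝ x ω : ℝ) : ℂ))))
      (Metric.ball 0 r) := by
    refine IntegrableOn.of_bound measure_ball_lt_top (Continuous.aestronglyMeasurable
      (by fun_prop)) 1 (Filter.Eventually.of_forall fun x => ?_)
    simp [Complex.norm_exp]
  have hint' : IntegrableOn (fun x => cexp (I * ((inner ℝ x ω : ℝ) : ℂ)))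
      (Metric.ball 0 r) := by
    refine IntegrableOn.of_bound measure_ball_lt_top (Continuous.aestronglyMeasurable
      (by fun_prop)) 1 (Filter.Eventually.of_forall fun x => ?_)
    simp [Complex.norm_exp]
  have hneg : ∫ x in Metric.ball 0 r, cexp (-(I * ((inner ℝ x ω : ℝ) : ℂ))) =
      ∫ x in Metric.ball 0 r, cexp (I * ((inner ℝ x ω : ℝ) : ℂ)) := by
    rw [← integral_indicator measurableSet_ball, ← integral_indicator measurableSet_ball,
      ← integral_neg_eq_self]
    congr 1 with x
    simp [Set.indicator]
  have hsum : ∫ x in Metric.ball 0 r, cexp (-(I * ((inner ℝ x ω : ℝ) : ℂ))) =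
      1 / 2 * (∫ x in Metric.ball 0 r, (cexp (-(I * ((inner ℝ x ω : ℝ) : ℂ))) +
        cexp (I * ((inner ℝ x ω : ℝ) : ℂ)))) := by
    rw [integral_add hint hint', ← hneg]
    ring
  rw [hsum, ← integral_const_mul, ← integral_complex_ofReal]
  congr 1 with x
  rw [Complex.ofReal_cos, Complex.cos]
  ring_nf

lemma hasSum_setIntegral_ball_cos_inner {n : ℕ} {ω : EuclideanSpace ℝ (Fin n)} (hω : ω ≠ 0)
    {r : ℝ} (hr : 0 < r) :
    HasSum (fun m : ℕ => √Real.pi ^ n * r ^ n * ((-1) ^ m / ((m ! : ℝ) *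
        Real.Gamma (m + (n : ℝ) / 2 + 1)) * (r * ‖ω‖ / 2) ^ (2 * m)))
      (∫ x in Metric.ball 0 r, Real.cos (inner ℝ x ω)) := by
  have hn : n ≠ 0 := by
    rintro rfl
    exact hω (Subsingleton.elim _ _)
  let F : ℕ → EuclideanSpace ℝ (Fin n) → ℝ :=
    fun m x => (-1) ^ m * inner ℝ x ω ^ (2 * m) / ((2 * m)! : ℝ)
  have hbound : ∀ m, ∀ x ∈ Metric.ball (0 : EuclideanSpace ℝ (Fin n)) r,
      ‖F m x‖ ≤ (r * ‖ω‖) ^ (2 * m) / ((2 * m)! : ℝ) := fun m x hx => by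
    rw [mem_ball_zero_iff] at hx
    simp only [F, norm_div, norm_mul, norm_pow, norm_neg, norm_one, one_pow, one_mul,
      Real.norm_natCast]
    gcongr
    exact (norm_inner_le_norm x ω).trans (by gcongr)
  have hFint : ∀ m, IntegrableOn (F m) (Metric.ball 0 r) := fun m =>
    IntegrableOn.of_bound measure_ball_lt_top (Continuous.aestronglyMeasurable
      (by fun_prop)) _ ((ae_restrict_mem measurableSet_ball).mono (hbound m))
  have hexp : Summable fun m : ℕ => (r * ‖ω‖) ^ (2 * m) / ((2 * m)! : ℝ) :=
    (Real.summable_pow_div_factorial (r * ‖ω‖)).comp_injective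
      (mul_right_injective₀ (two_ne_zero : (2 : ℕ) ≠ 0))
  have hsum : Summable fun m => ∫ x in Metric.ball 0 r, ‖F m x‖ := by
    refine Summable.of_nonneg_of_le (fun m => integral_nonneg fun x => norm_nonneg _)
      (fun m => ?_) (hexp.mul_left (volume.real (Metric.ball (0 : EuclideanSpace ℝ (Fin n)) r)))
    refine (setIntegral_mono_on (hFint m).norm (integrableOn_const measure_ball_lt_top.ne)
      measurableSet_ball (hbound m)).trans_eq ?_
    simp
  have h := hasSum_integral_of_summable_integral_norm hFint hsum
  have htsum : ∀ x, ∑' m, F m x = Real.cos (inner ℝ x ω) := fun x =>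
    (Real.hasSum_cos (inner ℝ x ω)).tsum_eq
  simp only [htsum] at h
  refine h.congr_fun fun m => ?_
  simp only [F]
  rw [integral_div, integral_const_mul, setIntegral_ball_inner_pow m hω hr,
    Real.Gamma_nat_add_half_eq_factorial, ← pow_sub_one_mul hn √Real.pi,
    show (4 : ℝ) ^ m = 2 ^ (2 * m) by rw [pow_mul]; norm_num]
  have hΓ : 0 < Real.Gamma (m + (n : ℝ) / 2 + 1) := Real.Gamma_pos_of_pos (by positivity)
  field_simp
  rw [div_pow, mul_pow, pow_add]
  field_simp

/-! ### Bessel functions -/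

lemma Gamma_add_one_le_Gamma_nat_add {ν : ℝ} (hν : 0 ≤ ν) (m : ℕ) :
    Real.Gamma (ν + 1) ≤ Real.Gamma (m + ν + 1) := by
  induction m with
  | zero => simp
  | succ m ih =>
    have hpos : 0 < (m : ℝ) + ν + 1 := by positivity
    rw [show ((m + 1 : ℕ) : ℝ) + ν + 1 = (m + ν + 1) + 1 by push_cast; ring,
      Real.Gamma_add_one hpos.ne']
    have hm : (0 : ℝ) ≤ m := Nat.cast_nonneg m
    nlinarith [Real.Gamma_pos_of_pos hpos]

lemma summable_norm_besselJ_series {ν : ℝ} (hν : 0 ≤ ν) (y : ℝ) :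
    Summable fun m : ℕ =>
      ‖(-1) ^ m / ((m ! : ℝ) * Real.Gamma (m + ν + 1)) * y ^ (2 * m)‖ := by
  have hΓ : 0 < Real.Gamma (ν + 1) := Real.Gamma_pos_of_pos (by positivity)
  refine Summable.of_nonneg_of_le (fun m => norm_nonneg _) (fun m => ?_)
    ((Real.summable_pow_div_factorial (y ^ 2)).mul_left (Real.Gamma (ν + 1))⁻¹)
  have hle := Gamma_add_one_le_Gamma_nat_add hν m
  rw [norm_mul, norm_div, norm_mul, norm_pow, norm_neg, norm_one, one_pow, Real.norm_natCast,
    Real.norm_of_nonneg (hΓ.le.trans hle), pow_mul, Real.norm_of_nonneg (by positivity)]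
  calc 1 / ((m ! : ℝ) * Real.Gamma (m + ν + 1)) * (y ^ 2) ^ m
      ≤ 1 / ((m ! : ℝ) * Real.Gamma (ν + 1)) * (y ^ 2) ^ m := by gcongr
    _ = _ := by field_simp

lemma rpow_two_mul_nat_add {y : ℝ} (hy : 0 < y) (m : ℕ) (ν : ℝ) :
    y ^ (2 * (m : ℝ) + ν) = y ^ (2 * m) * y ^ ν := by
  rw [Real.rpow_add hy, ← Real.rpow_natCast]
  push_cast
  rfl

/-- The Bessel function is a power times an entire even function. -/
lemma besselJ_eq_rpow_mul_tsum (ν : ℝ) {x : ℝ} (hx : 0 < x) :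
    besselJ ν x = (x / 2) ^ ν *
      ∑' m : ℕ, (-1) ^ m / ((m ! : ℝ) * Real.Gamma (m + ν + 1)) * (x / 2) ^ (2 * m) := by
  rw [besselJ, ← tsum_mul_left]
  congr 1 with m
  rw [rpow_two_mul_nat_add (by positivity)]
  ring

/-- The integrated form of `(x ^ ν * J_ν(x))' = x ^ ν * J_(ν - 1)(x)`, obtained by termwise
integration. -/
lemma integral_besselJ_sub_one_mul_rpow {ν a r : ℝ} (hν : 0 < ν) (ha : 0 < a) (hr : 0 < r) :
    ∫ ρ in (0 : ℝ)..r, besselJ (ν - 1) (a * ρ) * ρ ^ ν = r ^ ν / a * besselJ ν (a * r) := by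
  let c : ℕ → ℝ := fun m =>
    (-1) ^ m / ((m ! : ℝ) * Real.Gamma (m + (ν - 1) + 1)) * (a / 2) ^ (2 * (m : ℝ) + (ν - 1))
  let F : ℕ → ℝ → ℝ := fun m ρ => c m * ρ ^ (2 * (m : ℝ) + (2 * ν - 1))
  let s : ℕ → ℝ := fun m => (-1) ^ m / ((m ! : ℝ) * Real.Gamma (m + ν + 1)) *
    (a * r / 2) ^ (2 * m)
  have hexp : ∀ m : ℕ, -1 < 2 * (m : ℝ) + (2 * ν - 1) := fun m => by
    have : (0 : ℝ) ≤ m := Nat.cast_nonneg m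
    linarith
  -- This is where `0 < ν` is needed: the term with `m = 0` is integrable at the origin.
  have hF : ∀ m, IntegrableOn (F m) (Set.Ioc 0 r) := fun m =>
    ((intervalIntegrable_iff_integrableOn_Ioc_of_le hr.le).1
      (intervalIntegral.intervalIntegrable_rpow' (hexp m))).const_mul _
  have hpow : ∀ m : ℕ, ∫ ρ in Set.Ioc 0 r, ρ ^ (2 * (m : ℝ) + (2 * ν - 1)) =
      r ^ (2 * (m : ℝ) + 2 * ν) / (2 * m + 2 * ν) := fun m => by
    rw [← intervalIntegral.integral_of_le hr.le, integral_rpow (Or.inl (hexp m)),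
      show 2 * (m : ℝ) + (2 * ν - 1) + 1 = 2 * m + 2 * ν by ring,
      Real.zero_rpow (by positivity), sub_zero]
  have hterm : ∀ m : ℕ, c m * (r ^ (2 * (m : ℝ) + 2 * ν) / (2 * m + 2 * ν)) =
      r ^ ν / a * ((a * r / 2) ^ ν * s m) := fun m => by
    have hmν : 0 < (m : ℝ) + ν := by positivity
    have hΓ : 0 < Real.Gamma (m + ν) := Real.Gamma_pos_of_pos hmν
    simp only [c, s]
    rw [show (m : ℝ) + (ν - 1) + 1 = m + ν by ring, Real.Gamma_add_one hmν.ne',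
      rpow_two_mul_nat_add (by positivity), rpow_two_mul_nat_add hr,
      show a * r / 2 = a / 2 * r by ring, Real.mul_rpow (by positivity) hr.le, mul_pow,
      Real.rpow_sub_one (by positivity), two_mul ν, Real.rpow_add hr]
    field_simp
    ring
  have hval : ∀ m : ℕ, ∫ ρ in Set.Ioc 0 r, F m ρ = r ^ ν / a * ((a * r / 2) ^ ν * s m) :=
    fun m => by simp only [F]; rw [integral_const_mul, hpow, hterm]
  have hnorm : ∀ m : ℕ, ∫ ρ in Set.Ioc 0 r, ‖F m ρ‖ = r ^ ν / a * ((a * r / 2) ^ ν * ‖s m‖) :=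
    fun m => by
      have h1 : ∀ ρ ∈ Set.Ioc 0 r, ‖F m ρ‖ = ‖c m‖ * ρ ^ (2 * (m : ℝ) + (2 * ν - 1)) :=
        fun ρ hρ => by rw [norm_mul, Real.norm_of_nonneg (Real.rpow_nonneg hρ.1.le _)]
      rw [setIntegral_congr_fun measurableSet_Ioc h1, integral_const_mul, hpow]
      have hc : 0 ≤ r ^ (2 * (m : ℝ) + 2 * ν) / (2 * m + 2 * ν) := by positivity
      have h2 := congrArg norm (hterm m)
      rwa [norm_mul (c m), norm_mul (r ^ ν / a), norm_mul ((a * r / 2) ^ ν), Real.norm_of_nonneg hc,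
        Real.norm_of_nonneg (by positivity : 0 ≤ r ^ ν / a),
        Real.norm_of_nonneg (by positivity : 0 ≤ (a * r / 2) ^ ν)] at h2
  have hsum : Summable fun m => ∫ ρ in Set.Ioc 0 r, ‖F m ρ‖ := by
    simp only [hnorm]
    exact ((summable_norm_besselJ_series hν.le (a * r / 2)).mul_left _).mul_left _
  have h := (hasSum_integral_of_summable_integral_norm hF hsum).tsum_eq
  rw [intervalIntegral.integral_of_le hr.le, besselJ_eq_rpow_mul_tsum ν (by positivity),
    ← tsum_mul_left, ← tsum_mul_left]
  simp only [hval] at h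
  rw [h]
  refine setIntegral_congr_fun measurableSet_Ioc fun ρ hρ => ?_
  simp only [besselJ, F, c]
  rw [← tsum_mul_right]
  congr 1 with m
  rw [show a * ρ / 2 = a / 2 * ρ by ring, Real.mul_rpow (by positivity) hρ.1.le, mul_assoc,
    mul_assoc, mul_assoc, ← Real.rpow_add hρ.1]
  ring_nf

/-! ### Closed forms -/

/-- The Fourier integral of the ball, before normalization. -/
lemma setIntegral_ball_cexp_inner {n : ℕ} {ω : EuclideanSpace ℝ (Fin n)} (hω : ω ≠ 0)
    {r : ℝ} (hr : 0 < r) :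
    ∫ x in Metric.ball 0 r, cexp (-(I * ((inner ℝ x ω : ℝ) : ℂ))) =
      (((2 * Real.pi) ^ ((n : ℝ) / 2) *
        ((r / ‖ω‖) ^ ((n : ℝ) / 2) * besselJ ((n : ℝ) / 2) (r * ‖ω‖)) : ℝ) : ℂ) := by
  have hω' : 0 < ‖ω‖ := norm_pos_iff.2 hω
  rw [setIntegral_ball_cexp_inner_eq_cos, ← (hasSum_setIntegral_ball_cos_inner hω hr).tsum_eq,
    tsum_mul_left, besselJ_eq_rpow_mul_tsum _ (by positivity)]
  congr 1
  rw [← mul_assoc, ← mul_assoc, ← Real.mul_rpow (by positivity) (by positivity),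
    ← Real.mul_rpow (by positivity) (by positivity)]
  congr 1
  -- Both sides equal `(π r²) ^ (n / 2)`.
  rw [show 2 * Real.pi * (r / ‖ω‖) * (r * ‖ω‖ / 2) = (√Real.pi * r) ^ 2 by
      rw [mul_pow, Real.sq_sqrt Real.pi_pos.le]; field_simp,
    ← mul_pow, ← Real.rpow_natCast, ← Real.rpow_natCast, ← Real.rpow_mul (by positivity)]
  congr 1
  push_cast
  ring

lemma unitaryFourier_indicator_ball {n : ℕ} {ω : EuclideanSpace ℝ (Fin n)} (hω : ω ≠ 0)
    {r : ℝ} (hr : 0 < r) :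
    unitaryFourier (Set.indicator (Metric.ball 0 r) (fun _ => (1 : ℂ))) ω =
      (((r / ‖ω‖) ^ ((n : ℝ) / 2) * besselJ ((n : ℝ) / 2) (r * ‖ω‖) : ℝ) : ℂ) := by
  rw [unitaryFourier, ← setIntegral_cexp_inner measurableSet_ball,
    setIntegral_ball_cexp_inner hω hr, ← Complex.ofReal_mul, ← mul_assoc,
    ← Real.rpow_add (by positivity), neg_add_cancel, Real.rpow_zero, one_mul]

/-- The two closed forms differ by the recurrence of the Bessel functions. -/
lemma norm_rpow_mul_integral_besselJ {n : ℕ} {ω : EuclideanSpace ℝ (Fin n)} (hω : ω ≠ 0)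
    {r : ℝ} (hr : 0 < r) :
    ‖ω‖ ^ (-(((n : ℝ) - 2) / 2)) *
        ∫ ρ in (0 : ℝ)..r, besselJ (((n : ℝ) - 2) / 2) (‖ω‖ * ρ) * ρ ^ ((n : ℝ) / 2) =
      (r / ‖ω‖) ^ ((n : ℝ) / 2) * besselJ ((n : ℝ) / 2) (r * ‖ω‖) := by
  have hω' : 0 < ‖ω‖ := norm_pos_iff.2 hω
  have hn : 0 < n := by
    rcases Nat.eq_zero_or_pos n with rfl | h
    · exact absurd (Subsingleton.elim _ _) hω
    · exact h
  rw [show ((n : ℝ) - 2) / 2 = (n : ℝ) / 2 - 1 by ring,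
    integral_besselJ_sub_one_mul_rpow (by positivity) hω' hr,
    show -((n : ℝ) / 2 - 1) = 1 - (n : ℝ) / 2 by ring, Real.rpow_sub hω', Real.rpow_one,
    Real.div_rpow hr.le hω'.le, mul_comm ‖ω‖ r]
  field_simp

lemma volume_real_ball {n : ℕ} (hn : n ≠ 0) {r : ℝ} (hr : 0 < r) :
    volume.real (Metric.ball (0 : EuclideanSpace ℝ (Fin n)) r) =
      Real.pi ^ ((n : ℝ) / 2) * r ^ n / Real.Gamma ((n : ℝ) / 2 + 1) := by
  have : Nonempty (Fin n) := Fin.pos_iff_nonempty.1 (Nat.pos_of_ne_zero hn)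
  have hΓ : 0 < Real.Gamma ((n : ℝ) / 2 + 1) := Real.Gamma_pos_of_pos (by positivity)
  rw [measureReal_def, EuclideanSpace.volume_ball, Fintype.card_fin, ENNReal.toReal_mul,
    ENNReal.toReal_pow, ENNReal.toReal_ofReal hr.le, ENNReal.toReal_ofReal (by positivity),
    Real.sqrt_eq_rpow, ← Real.rpow_natCast (Real.pi ^ (1 / 2 : ℝ)), ← Real.rpow_mul Real.pi_pos.le]
  ring_nf

lemma averagingMultiplier_ball_eq_besselJ {n : ℕ} {ω : EuclideanSpace ℝ (Fin n)} (hω : ω ≠ 0)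
    {r : ℝ} (hr : 0 < r) :
    averagingMultiplier (Metric.ball 0 r) ω =
      (((2 * Real.pi) ^ ((n : ℝ) / 2) *
        (Real.Gamma ((n : ℝ) / 2 + 1) / Real.pi ^ ((n : ℝ) / 2)) *
        (besselJ ((n : ℝ) / 2) (r * ‖ω‖) / (r * ‖ω‖) ^ ((n : ℝ) / 2)) : ℝ) : ℂ) := by
  have hω' : 0 < ‖ω‖ := norm_pos_iff.2 hω
  have hn : n ≠ 0 := by
    rintro rfl
    exact hω (Subsingleton.elim _ _)
  have hΓ : 0 < Real.Gamma ((n : ℝ) / 2 + 1) := Real.Gamma_pos_of_pos (by positivity)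
  have hrn : r ^ n = r ^ ((n : ℝ) / 2) * r ^ ((n : ℝ) / 2) := by
    rw [← Real.rpow_add hr, add_halves, Real.rpow_natCast]
  rw [averagingMultiplier, setIntegral_ball_cexp_inner hω hr, volume_real_ball hn hr,
    ← Complex.ofReal_one, ← Complex.ofReal_div, ← Complex.ofReal_mul, hrn,
    Real.div_rpow hr.le hω'.le, Real.mul_rpow hr.le hω'.le]
  congr 1
  field_simp

theorem mainTheorem5 (n : ℕ) (r : ℝ) (hr : 0 < r) :
    -- the Fourier transform of the indicator function of the ball
    (∀ ω : EuclideanSpace ℝ (Fin n), ω ≠ 0 →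
      unitaryFourier (Set.indicator (Metric.ball 0 r) (fun _ => (1 : ℂ))) ω =
          ((‖ω‖ ^ (-(((n : ℝ) - 2) / 2)) *
            ∫ ρ in (0 : ℝ)..r, besselJ (((n : ℝ) - 2) / 2) (‖ω‖ * ρ) * ρ ^ ((n : ℝ) / 2) : ℝ) : ℂ) ∧
      unitaryFourier (Set.indicator (Metric.ball 0 r) (fun _ => (1 : ℂ))) ω =
          (((r / ‖ω‖) ^ ((n : ℝ) / 2) * besselJ ((n : ℝ) / 2) (r * ‖ω‖) : ℝ) : ℂ)) ∧
    -- the multiplier in closed form; at the origin it is the value by continuity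
    (∀ ω : EuclideanSpace ℝ (Fin n), ω ≠ 0 →
      averagingMultiplier (Metric.ball 0 r) ω =
        (((2 * Real.pi) ^ ((n : ℝ) / 2) *
          (Real.Gamma ((n : ℝ) / 2 + 1) / Real.pi ^ ((n : ℝ) / 2)) *
          (besselJ ((n : ℝ) / 2) (r * ‖ω‖) / (r * ‖ω‖) ^ ((n : ℝ) / 2)) : ℝ) : ℂ)) ∧
    averagingMultiplier (Metric.ball (0 : EuclideanSpace ℝ (Fin n)) r) 0 = 1 ∧
    -- it is smooth with derivatives of polynomial growth, so it multiplies tempered distributions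
    (averagingMultiplier (Metric.ball (0 : EuclideanSpace ℝ (Fin n)) r)).HasTemperateGrowth ∧
    -- integrable functions: pointwise identity
    (∀ f : EuclideanSpace ℝ (Fin n) → ℂ, Integrable f →
      Integrable (postAverage (Metric.ball 0 r) f) ∧
      (∀ ω : EuclideanSpace ℝ (Fin n),
        unitaryFourier (postAverage (Metric.ball 0 r) f) ω =
          unitaryFourier f ω * averagingMultiplier (Metric.ball 0 r) ω) ∧
      (∀ ω : EuclideanSpace ℝ (Fin n), ω ≠ 0 →
        unitaryFourier (postAverage (Metric.ball 0 r) f) ω =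
          unitaryFourier f ω *
            (((2 * Real.pi) ^ ((n : ℝ) / 2) *
              (Real.Gamma ((n : ℝ) / 2 + 1) / Real.pi ^ ((n : ℝ) / 2)) *
              (besselJ ((n : ℝ) / 2) (r * ‖ω‖) / (r * ‖ω‖) ^ ((n : ℝ) / 2)) : ℝ) : ℂ))) ∧
    -- tempered functions (such as piecewise linear ones): identity of tempered distributions
    (∀ f : EuclideanSpace ℝ (Fin n) → ℂ, IsTemperedFunction f →
      IsTemperedFunction (postAverage (Metric.ball 0 r) f) ∧
      ∀ ψ : 𝓢(EuclideanSpace ℝ (Fin n), ℂ),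
        distribFourier (postAverage (Metric.ball 0 r) f) ψ =
          distribFourier f (fun ω => averagingMultiplier (Metric.ball 0 r) ω * ψ ω)) := by
  refine ⟨fun ω hω => ⟨?_, unitaryFourier_indicator_ball hω hr⟩,
    fun ω hω => averagingMultiplier_ball_eq_besselJ hω hr, averagingMultiplier_ball_zero hr,
    hasTemperateGrowth_averagingMultiplier measurableSet_ball Metric.isBounded_ball,
    fun f hf => ⟨?_, unitaryFourier_postAverage hf, fun ω hω => ?_⟩,
    fun f hf => ⟨isTemperedFunction_postAverage hf, distribFourier_postAverage hf⟩⟩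
  · rw [norm_rpow_mul_integral_besselJ hω hr, unitaryFourier_indicator_ball hω hr]
  · simpa using integrable_postAverage_mul (r := r) (f := f) (h := fun _ => 1) (k := 0) (A := 1)
      (by simpa using hf) continuous_const (by simp)
  · rw [unitaryFourier_postAverage hf, averagingMultiplier_ball_eq_besselJ hω hr]
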